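/- Graphs are finite, may have parallel edges, and have no loops. A signature of a graph $G$ is a map $\sigma:E(G)\to\{\pm1\}$. Each edge $e=uv$ consists of two half-edges $h_e^u$ and $h_e^v$, incident with $u$ and $v$ respectively; $H(v)$ is the set of half-edges incident with $v$, and $e_h$ is the edge containing the half-edge $h$. An orientation of $(G,\sigma)$ is a map $\tau$ from the set of half-edges to $\{\pm1\}$ with $\tau(h_e^u)\tau(h_e^v)=-\sigma(e)$ for every edge $e=uv$. For a real number $r$, a nowhere-zero $r$-flow on $(G,\sigma)$ consists of an orientation $\tau$ and a function $f:E(G)\to\mathbb R$ such that $1\le|f(e)|\le r-1$ for every edge $e$ and $\sum_{h\in H(v)}\tau(h)f(e_h)=0$ for every vertex $v$. The signed graph $(G,\sigma)$ is flow-admissible if it has a nowhere-zero $r$-flow for some $r\ge 2$. The circular flow number $F_c((G,\sigma))$ is the infimum of all $r$ for which $(G,\sigma)$ has a nowhere-zero $r$-flow, and the integer flow number $F((G,\sigma))$ is the infimum of all $r$ for which it has an integer-valued one (each is $\infty$ if there is none). Let ${\cal S}(G)$ and $\overline{{\cal S}}(G)$ be the sets of real numbers that occur as $F_c((G,\sigma))$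 and as $F((G,\sigma))$, respectively, where $\sigma$ ranges over the signatures of $G$ for which $(G,\sigma)$ is flow-admissible. Let $K_2^3$ be the graph with two vertices joined by three parallel edges. **Theorem.** Let $G$ be a cubic graph which has a 1-factor, and suppose that at least one connected component of $G$ is not isomorphic to $K_2^3$ (for connected $G$ this says $G\ne K_2^3$). Then $\{3,4\}\subseteq{\cal S}(G)\cap\overline{{\cal S}}(G)$. Moreover, there is a signature $\sigma$ of $G$ with $F_c((G,\sigma))=F((G,\sigma))=3$, and there is a signature $\sigma$ of $G$ with $F_c((G,\sigma))=F((G,\sigma))=4$. -/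

import Mathlib

open scoped Graph

namespace Graph

/-- Every vertex is incident with exactly three edges (intended for loopless graphs, where this is
the degree). -/
def IsCubic {α β : Type*} (G : Graph α β) : Prop :=
  ∀ v ∈ G.vertexSet, (G.incidenceSet v).ncard = 3

/-- `M` is (the edge set of) a 1-factor of `G`: a set of edges such that every vertex of `G` is
incident with exactly one edge of `M`. -/
def IsOneFactor {α β : Type*} (G : Graph α β) (M : Set β) : Prop :=
  M ⊆ G.edgeSet ∧ ∀ v ∈ G.vertexSet, ∃! e, e ∈ M ∧ G.Inc e v

/-- `G` is a copy of `K_2^3`: two distinct vertices joined by three parallel edges. -/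
def IsTripleEdge {α β : Type*} (G : Graph α β) : Prop :=
  ∃ (u v : α) (F : Set β), u ≠ v ∧ F.ncard = 3 ∧ G = banana u v F

/-- `H` is a connected component of `G`: a minimal nonempty union of components. -/
def IsComponent {α β : Type*} (H G : Graph α β) : Prop :=
  Minimal (fun K : Graph α β => IsClosedSubgraph K G ∧ K.vertexSet.Nonempty) H

/-- A signature: a sign `1` or `-1` for every edge. -/
abbrev Signature {α β : Type*} (G : Graph α β) : Type _ := G.edgeSet → ℤˣ

/-- Half-edges. In a loopless graph the edge `e = uv` has the two half-edges `(e, u)`, `(e, v)`. -/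
structure HalfEdge {α β : Type*} (G : Graph α β) where
  edge : β
  vertex : α
  inc : G.Inc edge vertex

/-- The edge `e_h` that contains the half-edge `h`. -/
def HalfEdge.toEdge {α β : Type*} {G : Graph α β} (h : G.HalfEdge) : G.edgeSet :=
  ⟨h.edge, h.inc.edge_mem⟩

/-- `τ` is an orientation of `(G, σ)`: the product of the values of `τ` on the two half-edges of
an edge `e` is `-σ(e)`. -/
def IsOrientation {α β : Type*} (G : Graph α β) (σ : G.Signature) (τ : G.HalfEdge → ℤˣ) : Prop :=
  ∀ (e : β) (u v : α) (h : G.IsLink e u v),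
    τ ⟨e, u, h.inc_left⟩ * τ ⟨e, v, h.inc_right⟩ = -σ ⟨e, h.edge_mem⟩

/-- The boundary `δf(v) = ∑_{h ∈ H(v)} τ(h) f(e_h)`. -/
noncomputable def boundary {α β : Type*} (G : Graph α β) (τ : G.HalfEdge → ℤˣ)
    (f : G.edgeSet → ℝ) (v : α) : ℝ :=
  ∑ᶠ (h : G.HalfEdge) (_ : h.vertex = v), ((τ h : ℤ) : ℝ) * f h.toEdge

/-- `f` is an `r`-flow with respect to the orientation `τ`. -/
def IsFlow {α β : Type*} (G : Graph α β) (τ : G.HalfEdge → ℤˣ) (r : ℝ)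
    (f : G.edgeSet → ℝ) : Prop :=
  (∀ e, f e = 0 ∨ (1 ≤ |f e| ∧ |f e| ≤ r - 1)) ∧ ∀ v ∈ G.vertexSet, G.boundary τ f v = 0

/-- `(G, σ)` admits a nowhere-zero `r`-flow. -/
def HasNowhereZeroFlow {α β : Type*} (G : Graph α β) (σ : G.Signature) (r : ℝ) : Prop :=
  ∃ (τ : G.HalfEdge → ℤˣ) (f : G.edgeSet → ℝ),
    G.IsOrientation σ τ ∧ G.IsFlow τ r f ∧ ∀ e, f e ≠ 0

/-- `(G, σ)` admits an integer-valued nowhere-zero `r`-flow. -/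
def HasIntNowhereZeroFlow {α β : Type*} (G : Graph α β) (σ : G.Signature) (r : ℝ) : Prop :=
  ∃ (τ : G.HalfEdge → ℤˣ) (f : G.edgeSet → ℝ),
    G.IsOrientation σ τ ∧ G.IsFlow τ r f ∧ (∀ e, f e ≠ 0) ∧ ∀ e, ∃ n : ℤ, f e = n

/-- `(G, σ)` is flow-admissible. -/
def IsFlowAdmissible {α β : Type*} (G : Graph α β) (σ : G.Signature) : Prop :=
  ∃ r : ℝ, 2 ≤ r ∧ G.HasNowhereZeroFlow σ r

/-- The circular flow number `F_c((G, σ))`; it is `∞` if there is no nowhere-zero flow. -/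
noncomputable def circularFlowNumber {α β : Type*} (G : Graph α β) (σ : G.Signature) : EReal :=
  sInf ((fun r : ℝ => (r : EReal)) '' {r : ℝ | G.HasNowhereZeroFlow σ r})

/-- The integer flow number `F((G, σ))`; it is `∞` if there is no integer nowhere-zero flow. -/
noncomputable def integerFlowNumber {α β : Type*} (G : Graph α β) (σ : G.Signature) : EReal :=
  sInf ((fun r : ℝ => (r : EReal)) '' {r : ℝ | G.HasIntNowhereZeroFlow σ r})

/-- The flow spectrum of `G`. -/
def flowSpectrum {α β : Type*} (G : Graph α β) : Set ℝ :=
  {r | ∃ σ : G.Signature, G.IsFlowAdmissible σ ∧ G.circularFlowNumber σ = (r : EReal)}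

/-- The integer flow spectrum of `G`. -/
def integerFlowSpectrum {α β : Type*} (G : Graph α β) : Set ℝ :=
  {r | ∃ σ : G.Signature, G.IsFlowAdmissible σ ∧ G.integerFlowNumber σ = (r : EReal)}

end Graph

/-! At a cubic vertex one absolute flow value is the sum of the other two, so r ≥ 3; the values 2 on
a 1-factor M and 1 elsewhere attain 3 for the all-negative signature. If r < 4, exactly one edge at
each vertex has absolute value at least 2, and reversing these edges makes the signs at each vertex
agree: the signature is antibalanced (`HasNowhereZeroFlow.isAntibalanced`).

So 4 needs a signature that has an integer 4-flow and is not antibalanced. Each edge uv outside a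
1-factor M gives a candidate, with value 3 on uv. If all candidates are antibalanced, each yields a
cut consisting of the M-edges with exactly one end in {u, v}. A descent on such cuts
(`eq_of_crossing_pairs`) forces the two non-M edges at every vertex to be parallel. Exchanging M
with one edge of each parallel pair gives another 1-factor, and the same conclusion for it turns
every component into a triple edge. -/

/-- If the pairs `{u, mate u}`, `{v, mate v}` at the ends of every `N`-edge `uv` are exactly the
pairs separated by some union of `N`-components, then no union of `N`-components separates exactly
one pair. -/
theorem not_exists_single_crossing {W : Type*} [Finite W] (N : W → W → Prop) (mate : W → W)
    (hmate : ∀ p, mate (mate p) = p) (hne : ∀ p, mate p ≠ p)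
    (hN : ∀ u, ∃ v, v ≠ u ∧ N u v)
    (hcut : ∀ u v, N u v → ∃ X : Set W, (∀ p q, N p q → (p ∈ X ↔ q ∈ X)) ∧
      ∀ p, (p ∈ X ↔ mate p ∈ X) ↔ ((p = u ∨ p = v) ↔ (mate p = u ∨ mate p = v)))
    (X : Set W) (hX : ∀ p q, N p q → (p ∈ X ↔ q ∈ X)) (u : W) (hu : u ∈ X)
    (hmu : mate u ∉ X) (h : ∀ p ∈ X, p ≠ u → mate p ∈ X) : False := by
  induction hn : X.ncard using Nat.strong_induction_on generalizing X u with
  | _ n ih =>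
    obtain ⟨v, hvu, huv⟩ := hN u
    have hvX : v ∈ X := (hX u v huv).1 hu
    have hmv : mate v ∈ X := h v hvX hvu
    obtain ⟨Y, hYN, hY⟩ := hcut u v huv
    have huvY := hYN u v huv
    -- Descent: `Y` separates only the pairs of `u` and `v`, so the part of `X` across `Y` from `u`
    -- has `mate v` as its only crossing, and it omits `u`.
    have hsub : {p | p ∈ X ∧ ¬ (p ∈ Y ↔ u ∈ Y)} ⊂ X := by
      refine ⟨fun p hp => hp.1, fun hs => ?_⟩
      exact (hs hu).2 Iff.rfl
    refine ih _ (hn ▸ Set.ncard_lt_ncard hsub (Set.toFinite X)) _ ?_ (mate v) ?_ ?_ ?_ rfl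
    · intro p q hpq
      rw [Set.mem_ofPred_eq, Set.mem_ofPred_eq, hX p q hpq, hYN p q hpq]
    · have h1 : mate v ≠ u := fun h => hmu (by rw [← h, hmate]; exact hvX)
      have h2 := hY v
      have h3 := hne v
      refine ⟨hmv, ?_⟩
      tauto
    · rw [hmate]
      exact fun h => h.2 huvY.symm
    · intro p hp hpv
      have hpu : p ≠ u := fun h => hp.2 (h ▸ Iff.rfl)
      have hpv' : p ≠ v := fun h => hp.2 (h ▸ huvY.symm)
      have h1 : mate p ≠ u := fun h => hmu (by rw [← h, hmate]; exact hp.1)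
      have h2 : mate p ≠ v := fun h => hpv (by rw [← h, hmate])
      have h3 := hY p
      refine ⟨h p hp.1 hpu, ?_⟩
      have := hp.2
      tauto

/-- Under the hypothesis of `not_exists_single_crossing`, every vertex has a single
`N`-neighbour. -/
theorem eq_of_crossing_pairs {W : Type*} [Finite W] (N : W → W → Prop) (mate : W → W)
    (hmate : ∀ p, mate (mate p) = p) (hne : ∀ p, mate p ≠ p) (hirr : ∀ u v, N u v → u ≠ v)
    (hN : ∀ u, ∃ v, N u v)
    (hcut : ∀ u v, N u v → ∃ X : Set W, (∀ p q, N p q → (p ∈ X ↔ q ∈ X)) ∧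
      ∀ p, (p ∈ X ↔ mate p ∈ X) ↔ ((p = u ∨ p = v) ↔ (mate p = u ∨ mate p = v)))
    {a b c : W} (hab : N a b) (hbc : N b c) : a = c := by
  by_contra hac
  have hab' := hirr _ _ hab
  have hbc' := hirr _ _ hbc
  obtain ⟨X, hXN, hX⟩ := hcut a b hab
  obtain ⟨Y, hYN, hY⟩ := hcut b c hbc
  have hXab := hXN a b hab
  have hXbc := hXN b c hbc
  have hYab := hYN a b hab
  have hYbc := hYN b c hbc
  -- Otherwise `Y`, which separates the pair of `b`, would separate the `N`-neighbours `a` and `b`;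
  -- the next two claims are similar.
  have h1 : mate a ≠ b := by
    intro h
    have := hY a
    grind
  have h2 : mate b ≠ c := by
    intro h
    have := hX b
    grind
  have h3 : mate a ≠ c := by
    intro h
    have := hX a
    grind
  have h1' : mate b ≠ a := fun h => h1 (by rw [← h, hmate])
  have hXb := hX b
  have hYb := hY b
  have hb := hne b
  refine not_exists_single_crossing N mate hmate hne
    (fun u => (hN u).imp fun v hv => ⟨(hirr _ _ hv).symm, hv⟩) hcut
    -- The quadrant opposite `b`. The points `a`, `b`, `c` share one quadrant; the pair of `a`
    -- crosses only `X`, that of `c` only `Y`, and that of `b` both. Hence `mate b` is the single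
    -- crossing.
    {p | ¬ (p ∈ X ↔ b ∈ X) ∧ ¬ (p ∈ Y ↔ b ∈ Y)} ?_ (mate b) ?_ ?_ ?_
  · intro p q hpq
    rw [Set.mem_ofPred_eq, Set.mem_ofPred_eq, hXN p q hpq, hYN p q hpq]
  · rw [Set.mem_ofPred_eq]
    clear hXN hYN hcut hX hY
    grind
  · rw [hmate]
    simp
  · intro p hp hpb
    rw [Set.mem_ofPred_eq] at hp ⊢
    have hXp := hX p
    have hYp := hY p
    have hXm := hX (mate p)
    have hYm := hY (mate p)
    have h4 := hmate p
    have hpa : p ≠ a := by rintro rfl; exact hp.1 hXab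
    have hpb' : p ≠ b := by rintro rfl; exact hp.1 Iff.rfl
    have hpc : p ≠ c := by rintro rfl; exact hp.1 hXbc.symm
    have hmb : mate p ≠ b := fun h => hpb (by rw [← h, hmate])
    have hca : mate c ≠ a := fun h => h3 (by rw [← h, hmate])
    clear hXN hYN hcut hX hY hXb hYb
    grind

namespace Graph

variable {α β : Type*} {G : Graph α β}

/-! ### Local structure of cubic graphs -/

/-- In a cubic graph, the edges at a vertex are one edge of a 1-factor and two other edges. -/
theorem IsOneFactor.incidenceSet_eq {M : Set β} (hM : G.IsOneFactor M) (hG : G.IsCubic) {v : α}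
    (hv : v ∈ V(G)) :
    ∃ m a b, m ∈ M ∧ a ∉ M ∧ b ∉ M ∧ a ≠ b ∧ G.incidenceSet v = {m, a, b} := by
  obtain ⟨x, y, z, hxy, hxz, hyz, h⟩ := Set.ncard_eq_three.1 (hG v hv)
  obtain ⟨m, ⟨hmM, hm⟩, huniq⟩ := hM.2 v hv
  have hinc : ∀ e, G.Inc e v ↔ e = x ∨ e = y ∨ e = z := fun e => by
    rw [← G.mem_incidenceSet, h]; simp
  have hnot : ∀ e, G.Inc e v → e ≠ m → e ∉ M := fun e he hne heM => hne (huniq e ⟨heM, he⟩)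
  rcases (hinc m).1 hm with rfl | rfl | rfl
  · exact ⟨m, y, z, hmM, hnot y (by simp [hinc]) hxy.symm, hnot z (by simp [hinc]) hxz.symm, hyz, h⟩
  · refine ⟨m, x, z, hmM, hnot x (by simp [hinc]) hxy, hnot z (by simp [hinc]) hyz.symm, hxz, ?_⟩
    rw [h, Set.insert_comm]
  · refine ⟨m, x, y, hmM, hnot x (by simp [hinc]) hxz, hnot y (by simp [hinc]) hyz, hxy, ?_⟩
    rw [h, Set.pair_comm y m, Set.insert_comm]

theorem inc_of_incidenceSet_eq {v : α} {a b c : β} (h : G.incidenceSet v = {a, b, c}) :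
    G.Inc a v ∧ G.Inc b v ∧ G.Inc c v := by
  simp only [← G.mem_incidenceSet, h]
  simp

theorem boundary_eq_of_incidenceSet_eq (τ : G.HalfEdge → ℤˣ) (f : G.edgeSet → ℝ) {v : α} {a b c : β}
    (hab : a ≠ b) (hac : a ≠ c) (hbc : b ≠ c) (h : G.incidenceSet v = {a, b, c})
    (ha : G.Inc a v) (hb : G.Inc b v) (hc : G.Inc c v) :
    G.boundary τ f v = ((τ ⟨a, v, ha⟩ : ℤ) : ℝ) * f ⟨a, ha.edge_mem⟩ +
      ((τ ⟨b, v, hb⟩ : ℤ) : ℝ) * f ⟨b, hb.edge_mem⟩ +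
      ((τ ⟨c, v, hc⟩ : ℤ) : ℝ) * f ⟨c, hc.edge_mem⟩ := by
  have hset : {k : G.HalfEdge | k.vertex = v} = {⟨a, v, ha⟩, ⟨b, v, hb⟩, ⟨c, v, hc⟩} := by
    ext ⟨e, w, he⟩
    simp only [Set.mem_ofPred_eq, Set.mem_insert_iff, Set.mem_singleton_iff, HalfEdge.mk.injEq]
    constructor
    · rintro rfl
      have : e ∈ G.incidenceSet w := he
      rw [h] at this
      simpa using this
    · rintro (h | h | h) <;> exact h.2
  change ∑ᶠ (k) (_ : k ∈ {k : G.HalfEdge | k.vertex = v}), _ = _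
  rw [hset, finsum_mem_insert _ (by simp [hab, hac]) (Set.toFinite _),
    finsum_mem_insert _ (by simp [hbc]) (Set.toFinite _), finsum_mem_singleton, ← add_assoc]
  rfl

/-- Every assignment of signs to the half-edges is an orientation for some signature. -/
theorem exists_isOrientation (τ : G.HalfEdge → ℤˣ) : ∃ σ : G.Signature, G.IsOrientation σ τ := by
  choose x y hxy using fun e : G.edgeSet => exists_isLink_of_mem_edgeSet e.2
  refine ⟨fun e => -(τ ⟨e, x e, (hxy e).inc_left⟩ * τ ⟨e, y e, (hxy e).inc_right⟩), ?_⟩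
  intro e u v h
  rw [neg_neg]
  have aux : ∀ p q (h' : G.IsLink e p q), τ ⟨e, u, h.inc_left⟩ * τ ⟨e, v, h.inc_right⟩ =
      τ ⟨e, p, h'.inc_left⟩ * τ ⟨e, q, h'.inc_right⟩ := by
    intro p q h'
    rcases h.eq_and_eq_or_eq_and_eq h' with ⟨rfl, rfl⟩ | ⟨rfl, rfl⟩
    · rfl
    · exact mul_comm _ _
  exact aux _ _ (hxy ⟨e, h.edge_mem⟩)

/-! ### Lower bounds on r and antibalanced signatures -/

/-- `σ` is switching equivalent to the all-negative signature. -/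
def IsAntibalanced (G : Graph α β) (σ : G.Signature) : Prop :=
  ∃ x : α → ℤˣ, ∀ (e : β) (u v : α) (h : G.IsLink e u v), σ ⟨e, h.edge_mem⟩ = -(x u * x v)

/-- In a cubic graph with a vertex, a nowhere-zero `r`-flow needs `r ≥ 3`. -/
theorem HasNowhereZeroFlow.three_le {σ : G.Signature} {r : ℝ} (h : G.HasNowhereZeroFlow σ r)
    (hG : G.IsCubic) (hV : V(G).Nonempty) : 3 ≤ r := by
  obtain ⟨τ, f, -, ⟨hf, hb⟩, hne⟩ := h
  obtain ⟨v, hv⟩ := hV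
  obtain ⟨a, b, c, hab, hac, hbc, h⟩ := Set.ncard_eq_three.1 (hG v hv)
  obtain ⟨ha, hb', hc⟩ := inc_of_incidenceSet_eq h
  have h0 := hb v hv
  rw [boundary_eq_of_incidenceSet_eq τ f hab hac hbc h ha hb' hc] at h0
  have hfa := (hf ⟨a, ha.edge_mem⟩).resolve_left (hne _)
  have hfb := (hf ⟨b, hb'.edge_mem⟩).resolve_left (hne _)
  have hfc := (hf ⟨c, hc.edge_mem⟩).resolve_left (hne _)
  generalize f ⟨a, ha.edge_mem⟩ = A at *
  generalize f ⟨b, hb'.edge_mem⟩ = B at *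
  generalize f ⟨c, hc.edge_mem⟩ = C at *
  by_contra! hr
  rcases Int.units_eq_one_or (τ ⟨a, v, ha⟩) with h1 | h1 <;>
  rcases Int.units_eq_one_or (τ ⟨b, v, hb'⟩) with h2 | h2 <;>
  rcases Int.units_eq_one_or (τ ⟨c, v, hc⟩) with h3 | h3 <;>
  simp only [h1, h2, h3, Units.val_one, Units.val_neg, Int.cast_one, Int.cast_neg] at h0 <;>
  rcases abs_cases A with hA | hA <;> rcases abs_cases B with hB | hB <;>
  rcases abs_cases C with hC | hC <;> linarith

theorem units_mul_eq_mul_abs (s : ℤˣ) (A : ℝ) :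
    ((s : ℤ) : ℝ) * A = (((s * if 0 < A then 1 else -1 : ℤˣ) : ℤ) : ℝ) * |A| := by
  split_ifs with h
  · rw [mul_one, abs_of_pos h]
  · rw [abs_of_nonpos (not_lt.1 h)]
    simp

/-- If three signed reals with absolute values in `[1, 3)` sum to zero, then their signs agree once
the sign of the terms of absolute value at least `2` is reversed. -/
theorem sign_eq_sign_of_sum_eq_zero {s t w : ℤˣ} {A B C r : ℝ} (hr : r < 4)
    (hA : 1 ≤ |A| ∧ |A| ≤ r - 1) (hB : 1 ≤ |B| ∧ |B| ≤ r - 1) (hC : 1 ≤ |C| ∧ |C| ≤ r - 1)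
    (h : ((s : ℤ) : ℝ) * A + ((t : ℤ) : ℝ) * B + ((w : ℤ) : ℝ) * C = 0) :
    s * ((if 0 < A then 1 else -1) * if 2 ≤ |A| then -1 else 1) =
      t * ((if 0 < B then 1 else -1) * if 2 ≤ |B| then -1 else 1) := by
  rw [units_mul_eq_mul_abs s, units_mul_eq_mul_abs t, units_mul_eq_mul_abs w] at h
  rw [← mul_assoc, ← mul_assoc]
  generalize (s * if 0 < A then 1 else -1) = s' at *
  generalize (t * if 0 < B then 1 else -1) = t' at *
  generalize (w * if 0 < C then 1 else -1) = w' at *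
  -- The signs are not all equal. The term with the lone sign has absolute value the sum of the
  -- other two, hence at least 2, and each of the others is at most `r - 2 < 2`.
  rcases Int.units_eq_one_or s' with rfl | rfl <;>
  rcases Int.units_eq_one_or t' with rfl | rfl <;>
  rcases Int.units_eq_one_or w' with rfl | rfl <;>
  simp only [Units.val_one, Units.val_neg, Int.cast_one, Int.cast_neg] at h <;>
  split_ifs <;> first | rfl | (exfalso; linarith)

/-- In a cubic graph, a signature with a nowhere-zero `r`-flow for some `r < 4` is
antibalanced. -/
theorem HasNowhereZeroFlow.isAntibalanced {σ : G.Signature} {r : ℝ} (h : G.HasNowhereZeroFlow σ r)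
    (hG : G.IsCubic) (hr : r < 4) : G.IsAntibalanced σ := by
  classical
  obtain ⟨τ, f, hτ, ⟨hf, hb⟩, hne⟩ := h
  have hf' := fun e => (hf e).resolve_left (hne e)
  let y : G.edgeSet → ℤˣ := fun e => (if 0 < f e then 1 else -1) * if 2 ≤ |f e| then -1 else 1
  have key : ∀ v e e' (he : G.Inc e v) (he' : G.Inc e' v),
      τ ⟨e, v, he⟩ * y ⟨e, he.edge_mem⟩ = τ ⟨e', v, he'⟩ * y ⟨e', he'.edge_mem⟩ := by
    intro v e e' he he'
    by_cases hee : e = e'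
    · subst hee; rfl
    have hv := he.vertex_mem
    obtain ⟨c, hce, hce', hs⟩ : ∃ c, e ≠ c ∧ e' ≠ c ∧ G.incidenceSet v = {e, e', c} := by
      have hsub : ({e, e'} : Set β) ⊆ G.incidenceSet v := by
        rintro _ (rfl | rfl) <;> assumption
      have h3 := hG v hv
      have hfin : (G.incidenceSet v).Finite := Set.finite_of_ncard_ne_zero (by omega)
      obtain ⟨c, hc⟩ := Set.ncard_eq_one.1 (show (G.incidenceSet v \ {e, e'}).ncard = 1 by
        rw [Set.ncard_sdiff hsub (Set.toFinite _), h3, Set.ncard_pair hee])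
      have hcm : c ∈ G.incidenceSet v \ {e, e'} := by rw [hc]; rfl
      simp only [Set.mem_sdiff, Set.mem_insert_iff, Set.mem_singleton_iff, not_or] at hcm
      refine ⟨c, Ne.symm hcm.2.1, Ne.symm hcm.2.2, ?_⟩
      rw [← Set.union_sdiff_cancel hsub, hc]
      ext
      simp only [Set.mem_union, Set.mem_insert_iff, Set.mem_singleton_iff, or_assoc]
    have hc := (inc_of_incidenceSet_eq hs).2.2
    have h0 := hb v hv
    rw [boundary_eq_of_incidenceSet_eq τ f hee hce hce' hs he he' hc] at h0
    exact sign_eq_sign_of_sum_eq_zero hr (hf' _) (hf' _) (hf' _) h0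
  -- The common value of `τ * y` at `v` is the switching function; the default 1 occurs only where
  -- no edge is incident.
  let x : α → ℤˣ := fun v => if h : ∃ e, G.Inc e v then
    τ ⟨h.choose, v, h.choose_spec⟩ * y ⟨h.choose, h.choose_spec.edge_mem⟩ else 1
  have hx : ∀ v e (he : G.Inc e v), x v = τ ⟨e, v, he⟩ * y ⟨e, he.edge_mem⟩ := by
    intro v e he
    have h : ∃ e, G.Inc e v := ⟨e, he⟩
    simp only [x, dif_pos h]
    exact key v _ _ _ _
  refine ⟨x, fun e u v h => ?_⟩
  rw [hx u e h.inc_left, hx v e h.inc_right, mul_mul_mul_comm, hτ e u v h, Int.units_mul_self,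
    mul_one, neg_neg]

/-! ### Explicit flows from a 1-factor -/

/-- A cubic graph with a 1-factor has an integer nowhere-zero 3-flow for the all-negative
signature: the edges of the 1-factor get the value `2`, the others `1`. -/
theorem IsOneFactor.hasIntNowhereZeroFlow_three {M : Set β} (hM : G.IsOneFactor M)
    (hG : G.IsCubic) : G.HasIntNowhereZeroFlow (fun _ => -1) 3 := by
  classical
  refine ⟨fun h => if h.edge ∈ M then -1 else 1, fun e => if e.1 ∈ M then 2 else 1, ?_, ⟨?_, ?_⟩,
    ?_, ?_⟩
  · intro e u v h
    dsimp only
    rw [neg_neg, Int.units_mul_self]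
  · intro e
    right
    dsimp only
    split_ifs <;> norm_num
  · intro v hv
    obtain ⟨m, a, b, hm, ha, hb, hab, h⟩ := hM.incidenceSet_eq hG hv
    obtain ⟨hmv, hav, hbv⟩ := inc_of_incidenceSet_eq h
    rw [boundary_eq_of_incidenceSet_eq _ _ (ne_of_mem_of_not_mem hm ha)
      (ne_of_mem_of_not_mem hm hb) hab h hmv hav hbv]
    simp only [if_pos hm, if_neg ha, if_neg hb]
    norm_num
  · intro e
    dsimp only
    split_ifs <;> norm_num
  · intro e
    by_cases h : e.1 ∈ M
    · exact ⟨2, by simp [h]⟩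
    · exact ⟨1, by simp [h]⟩

/-- Given a 1-factor `M` of a cubic graph and an edge `uv` outside `M`, there is an integer
nowhere-zero 4-flow with value `3` on `uv`, value `2` on `M` and value `1` elsewhere, whose signature
is antibalanced only if the edges of `M` with exactly one end in `{u, v}` form a cut. -/
theorem IsOneFactor.exists_hasIntNowhereZeroFlow_four {M : Set β} (hM : G.IsOneFactor M)
    (hG : G.IsCubic) {e₀ : β} {u v : α} (h₀ : G.IsLink e₀ u v) (he₀ : e₀ ∉ M) :
    ∃ σ : G.Signature, G.HasIntNowhereZeroFlow σ 4 ∧ (G.IsAntibalanced σ → ∃ X : Set α,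
      (∀ e p q, e ∉ M → G.IsLink e p q → (p ∈ X ↔ q ∈ X)) ∧
      ∀ e p q, e ∈ M → G.IsLink e p q →
        ((p ∈ X ↔ q ∈ X) ↔ ((p = u ∨ p = v) ↔ (q = u ∨ q = v)))) := by
  classical
  -- The signs balance 3 = 2 + 1 at `u` and `v`, and 2 = 1 + 1 at every other vertex.
  let t : β → α → ℤˣ := fun e p =>
    if p = u ∨ p = v then (if e = e₀ then -1 else 1) else (if e ∈ M then -1 else 1)
  obtain ⟨σ, hσ⟩ := exists_isOrientation (fun h : G.HalfEdge => t h.edge h.vertex)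
  have hends : ∀ p, G.Inc e₀ p ↔ p = u ∨ p = v := fun p =>
    ⟨fun h => h.eq_or_eq_of_isLink h₀, by rintro (rfl | rfl); exacts [h₀.inc_left, h₀.inc_right]⟩
  refine ⟨σ, ⟨_, fun e => if e.1 = e₀ then 3 else if e.1 ∈ M then 2 else 1, hσ, ⟨?_, ?_⟩, ?_, ?_⟩,
    ?_⟩
  · intro e
    right
    dsimp only
    split_ifs <;> norm_num
  · intro p hp
    obtain ⟨m, a, b, hm, ha, hb, hab, h⟩ := hM.incidenceSet_eq hG hp
    obtain ⟨hmp, hap, hbp⟩ := inc_of_incidenceSet_eq h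
    have hm0 : m ≠ e₀ := ne_of_mem_of_not_mem hm he₀
    rw [boundary_eq_of_incidenceSet_eq _ _ (ne_of_mem_of_not_mem hm ha)
      (ne_of_mem_of_not_mem hm hb) hab h hmp hap hbp]
    simp only [t, if_pos hm, if_neg ha, if_neg hb, if_neg hm0]
    by_cases hpuv : p = u ∨ p = v
    · simp only [if_pos hpuv]
      have h1 : e₀ ∈ G.incidenceSet p := (hends p).2 hpuv
      rw [h] at h1
      rcases h1 with h1 | h1 | h1
      · exact absurd h1.symm hm0
      · subst h1
        simp only [if_neg hab.symm]
        norm_num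
      · have h1 : e₀ = b := h1
        subst h1
        simp only [if_neg hab]
        norm_num
    · have ha0 : a ≠ e₀ := by rintro rfl; exact hpuv ((hends p).1 hap)
      have hb0 : b ≠ e₀ := by rintro rfl; exact hpuv ((hends p).1 hbp)
      simp only [if_neg hpuv, if_neg ha0, if_neg hb0]
      norm_num
  · intro e
    dsimp only
    split_ifs <;> norm_num
  · intro e
    dsimp only
    split_ifs
    exacts [⟨3, by norm_num⟩, ⟨2, by norm_num⟩, ⟨1, by norm_num⟩]
  · rintro ⟨x, hx⟩
    have key : ∀ e p q, G.IsLink e p q → t e p * t e q = x p * x q := by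
      intro e p q h
      have := hσ e p q h
      rw [hx e p q h, neg_neg] at this
      exact this
    have hmem : ∀ p q, (x p = 1 ↔ x q = 1) ↔ x p * x q = 1 := by
      intro p q
      rcases Int.units_eq_one_or (x p) with h | h <;>
      rcases Int.units_eq_one_or (x q) with h' | h' <;> simp [h, h']
    -- By `key`, an edge crosses this set exactly when its two half-edge signs differ. They agree
    -- outside `M`, and on `M` they differ exactly when one end lies in `{u, v}`.
    refine ⟨{p | x p = 1}, ?_, ?_⟩
    · intro e p q he h
      simp only [Set.mem_ofPred_eq]
      rw [hmem, ← key e p q h]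
      by_cases h0 : e = e₀
      · subst h0
        have hp := (hends p).1 h.inc_left
        have hq := (hends q).1 h.inc_right
        simp [t, hp, hq]
      · simp [t, h0, he]
    · intro e p q he h
      have h0 : e ≠ e₀ := ne_of_mem_of_not_mem he he₀
      simp only [Set.mem_ofPred_eq]
      rw [hmem, ← key e p q h]
      by_cases hp : p = u ∨ p = v <;> by_cases hq : q = u ∨ q = v <;> simp [t, h0, he, hp, hq]

/-! ### From cuts to parallel edges and triple-edge components -/

/-- If for every edge `uv` outside the 1-factor `M` the edges of `M` with exactly one end in
`{u, v}` form a cut, then the edges outside `M` at a vertex are parallel. -/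
theorem IsOneFactor.eq_of_isLink_of_isLink {M : Set β} (hM : G.IsOneFactor M) (hG : G.IsCubic)
    (hV : V(G).Finite) (hloop : G.Loopless)
    (hcut : ∀ e u v, e ∉ M → G.IsLink e u v → ∃ X : Set α,
      (∀ e p q, e ∉ M → G.IsLink e p q → (p ∈ X ↔ q ∈ X)) ∧
      ∀ e p q, e ∈ M → G.IsLink e p q →
        ((p ∈ X ↔ q ∈ X) ↔ ((p = u ∨ p = v) ↔ (q = u ∨ q = v))))
    {e f : β} {a b c : α} (he : e ∉ M) (hf : f ∉ M) (hab : G.IsLink e a b)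
    (hbc : G.IsLink f b c) : a = c := by
  have : Finite V(G) := hV
  have hne : ∀ {e p q}, G.IsLink e p q → p ≠ q := by
    rintro e p _ h rfl
    exact hloop.not_isLoopAt e p h
  have hex : ∀ p : V(G), ∃ q : V(G), ∃ e ∈ M, G.IsLink e p q := by
    intro p
    obtain ⟨e, ⟨heM, q, hq⟩, -⟩ := hM.2 p p.2
    exact ⟨⟨q, hq.right_mem⟩, e, heM, hq⟩
  choose mate k hkM hk using hex
  have hmate : ∀ p, mate (mate p) = p := by
    intro p
    have h1 := (hM.2 _ (mate p).2).unique ⟨hkM p, (hk p).inc_right⟩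
      ⟨hkM (mate p), (hk (mate p)).inc_left⟩
    have h2 := hk (mate p)
    rw [← h1] at h2
    exact Subtype.ext (h2.right_unique (hk p).symm)
  have := eq_of_crossing_pairs (fun p q : V(G) => ∃ e ∉ M, G.IsLink e p q) mate hmate
    (fun p h => hne (hk p) (congrArg Subtype.val h.symm))
    (fun u v ⟨e, _, h⟩ huv => hne h (congrArg Subtype.val huv)) ?_ ?_
    (a := ⟨a, hab.left_mem⟩) (b := ⟨b, hab.right_mem⟩) (c := ⟨c, hbc.right_mem⟩)
    ⟨e, he, hab⟩ ⟨f, hf, hbc⟩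
  · exact congrArg Subtype.val this
  · intro p
    obtain ⟨m, x, y, hm, hx, hy, hxy, h⟩ := hM.incidenceSet_eq hG p.2
    obtain ⟨q, hq⟩ := (inc_of_incidenceSet_eq h).2.1
    exact ⟨⟨q, hq.right_mem⟩, x, hx, hq⟩
  · rintro u v ⟨e, he, h⟩
    obtain ⟨X, hX1, hX2⟩ := hcut e u v he h
    refine ⟨{p | p.1 ∈ X}, fun p q ⟨e, he, h⟩ => hX1 e p q he h, fun p => ?_⟩
    have := hX2 _ _ _ (hkM p) (hk p)
    simpa only [Subtype.ext_iff, Set.mem_ofPred_eq] using this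

/-- If the edges outside `M` at each vertex are parallel, for every 1-factor `M` of a cubic graph,
then all components are triple edges. -/
theorem IsComponent.isTripleEdge {H : Graph α β} (hH : H.IsComponent G) (hG : G.IsCubic)
    (hloop : G.Loopless) (hfactor : ∃ M : Set β, G.IsOneFactor M)
    (hpar : ∀ M, G.IsOneFactor M → ∀ e f a b c, e ∉ M → f ∉ M → G.IsLink e a b →
      G.IsLink f b c → a = c) : H.IsTripleEdge := by
  obtain ⟨M, hM⟩ := hfactor
  obtain ⟨⟨hHG, u, hu⟩, hmin⟩ := hH
  have huG : u ∈ V(G) := hHG.le.1 hu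
  let S : α → Set β := fun p => {e | e ∉ M ∧ G.Inc e p}
  have hS : ∀ e p q, e ∉ M → G.IsLink e p q → S p ⊆ S q := by
    rintro e p q he h f ⟨hf, r, hr⟩
    have := hpar M hM e f q p r he hf h.symm hr
    exact ⟨hf, this ▸ hr.inc_right⟩
  have hSne : ∀ p ∈ V(G), (S p).Nonempty := by
    intro p hp
    obtain ⟨m, x, y, hm, hx, hy, hxy, h⟩ := hM.incidenceSet_eq hG hp
    exact ⟨x, hx, (inc_of_incidenceSet_eq h).2.1⟩
  -- The choice depends only on the set `S p`, which is the same at both ends of a non-`M` edge, so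
  -- both ends select the same edge and the selected edges form a 1-factor.
  obtain ⟨k, hk⟩ : ∃ k : Set β → β, ∀ T, T.Nonempty → k T ∈ T := by
    classical
    have : Nonempty β := ⟨(hSne u huG).some⟩
    exact ⟨fun T => if h : T.Nonempty then h.some else Classical.arbitrary β, fun T hT => by
      simpa only [dif_pos hT] using hT.some_mem⟩
  have hkS := fun p hp => hk (S p) (hSne p hp)
  have hM' : G.IsOneFactor {e | ∃ p ∈ V(G), e = k (S p)} := by
    refine ⟨?_, fun p hp => ⟨k (S p), ⟨⟨p, hp, rfl⟩, (hkS p hp).2⟩, ?_⟩⟩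
    · rintro _ ⟨p, hp, rfl⟩
      exact (hkS p hp).2.edge_mem
    · rintro _ ⟨⟨q, hq, rfl⟩, h⟩
      obtain ⟨hq1, r, hr⟩ := hkS q hq
      rcases h.eq_or_eq_of_isLink hr with rfl | rfl
      · rfl
      · rw [(hS _ _ _ hq1 hr).antisymm (hS _ _ _ hq1 hr.symm)]
  obtain ⟨m, a, b, hm, ha, hb, hab, h⟩ := hM.incidenceSet_eq hG huG
  obtain ⟨⟨w, hw⟩, ⟨v, hv⟩, ⟨v', hv'⟩⟩ := inc_of_incidenceSet_eq h
  obtain rfl : v = v' := hpar M hM a b v u v' ha hb hv.symm hv'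
  have hmM' : m ∉ {e | ∃ p ∈ V(G), e = k (S p)} := by
    rintro ⟨p, hp, rfl⟩
    exact (hkS p hp).1 hm
  -- One of `a`, `b` lies outside the new 1-factor, as does `m`; hence these two are parallel.
  obtain rfl : v = w := by
    by_cases haM' : a ∈ {e | ∃ p ∈ V(G), e = k (S p)}
    · have hbM' : b ∉ {e | ∃ p ∈ V(G), e = k (S p)} := fun hbM' =>
        hab ((hM'.2 u huG).unique ⟨haM', hv.inc_left⟩ ⟨hbM', hv'.inc_left⟩)
      exact hpar _ hM' b m v u w hbM' hmM' hv'.symm hw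
    · exact hpar _ hM' a m v u w haM' hmM' hv.symm hw
  have huv : u ≠ v := by
    rintro rfl
    exact hloop.not_isLoopAt _ _ hv
  have hlink : ∀ e ∈ ({m, a, b} : Set β), G.IsLink e u v := by
    rintro e (rfl | rfl | rfl) <;> assumption
  have hcard : ({m, a, b} : Set β).ncard = 3 := h ▸ hG u huG
  have hv3 : G.incidenceSet v = {m, a, b} := by
    have h3 := hG v hv.right_mem
    have hsub : {m, a, b} ⊆ G.incidenceSet v := fun e he => (hlink e he).inc_right
    exact (Set.eq_of_subset_of_ncard_le hsub (by omega)
      (Set.finite_of_ncard_ne_zero (by omega))).symm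
  refine ⟨u, v, {m, a, b}, huv, hcard, ?_⟩
  have hclosed : banana u v {m, a, b} ≤c G := by
    refine IsClosedSubgraph.mk' ⟨?_, ?_⟩ ?_
    · rintro p (rfl | rfl)
      exacts [huG, hv.right_mem]
    · rintro e p q ⟨he, ⟨rfl, rfl⟩ | ⟨rfl, rfl⟩⟩
      exacts [hlink e he, (hlink e he).symm]
    · rintro e p he (rfl | rfl)
      · exact h ▸ he
      · exact hv3 ▸ he
  have hle : banana u v {m, a, b} ≤ H := by
    have hlinkH : ∀ e ∈ ({m, a, b} : Set β), H.IsLink e u v := fun e he =>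
      (hHG.isLink_congr hu).2 (hlink e he)
    refine ⟨?_, ?_⟩
    · rintro p (rfl | rfl)
      exacts [hu, (hlinkH a (by simp)).right_mem]
    · rintro e p q ⟨he, ⟨rfl, rfl⟩ | ⟨rfl, rfl⟩⟩
      exacts [hlinkH e he, (hlinkH e he).symm]
  exact (hmin ⟨hclosed, u, Or.inl rfl⟩ hle).antisymm hle

/-! ### Flow numbers and conclusion -/

theorem HasIntNowhereZeroFlow.hasNowhereZeroFlow {σ : G.Signature} {r : ℝ}
    (h : G.HasIntNowhereZeroFlow σ r) : G.HasNowhereZeroFlow σ r := by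
  obtain ⟨τ, f, hτ, hf, hne, -⟩ := h
  exact ⟨τ, f, hτ, hf, hne⟩

/-- An integer flow is also a real one, so `r` is the least element of both sets of admissible
values. -/
theorem circularFlowNumber_eq_of_forall_le {σ : G.Signature} {r : ℝ}
    (h : G.HasIntNowhereZeroFlow σ r) (hr : ∀ s, G.HasNowhereZeroFlow σ s → r ≤ s) :
    G.circularFlowNumber σ = r ∧ G.integerFlowNumber σ = r := by
  constructor
  · refine IsLeast.csInf_eq ⟨⟨r, h.hasNowhereZeroFlow, rfl⟩, ?_⟩
    rintro _ ⟨s, hs, rfl⟩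
    exact EReal.coe_le_coe_iff.2 (hr s hs)
  · refine IsLeast.csInf_eq ⟨⟨r, h, rfl⟩, ?_⟩
    rintro _ ⟨s, hs, rfl⟩
    exact EReal.coe_le_coe_iff.2 (hr s hs.hasNowhereZeroFlow)

end Graph

theorem theorem5p5 {α β : Type*} (G : Graph α β) (hV : G.vertexSet.Finite)
    (hE : G.edgeSet.Finite) (hloop : G.Loopless) (hcubic : G.IsCubic)
    (hfactor : ∃ M : Set β, G.IsOneFactor M)
    (hK : ∃ H : Graph α β, H.IsComponent G ∧ ¬ H.IsTripleEdge) :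
    ({3, 4} : Set ℝ) ⊆ G.flowSpectrum ∩ G.integerFlowSpectrum ∧
    (∃ σ : G.Signature, G.circularFlowNumber σ = 3 ∧ G.integerFlowNumber σ = 3) ∧
    (∃ σ : G.Signature, G.circularFlowNumber σ = 4 ∧ G.integerFlowNumber σ = 4) := by
  obtain ⟨H, hH, hH3⟩ := hK
  have hne : V(G).Nonempty := hH.1.2.mono hH.1.1.le.1
  obtain ⟨σ₃, hσ₃, hadm₃⟩ : ∃ σ : G.Signature,
      (G.circularFlowNumber σ = (3 : ℝ) ∧ G.integerFlowNumber σ = (3 : ℝ)) ∧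
      G.IsFlowAdmissible σ := by
    obtain ⟨M, hM⟩ := hfactor
    have h := hM.hasIntNowhereZeroFlow_three hcubic
    exact ⟨_, Graph.circularFlowNumber_eq_of_forall_le h fun s hs => hs.three_le hcubic hne,
      3, by norm_num, h.hasNowhereZeroFlow⟩
  obtain ⟨σ₄, hσ₄, hadm₄⟩ : ∃ σ : G.Signature,
      (G.circularFlowNumber σ = (4 : ℝ) ∧ G.integerFlowNumber σ = (4 : ℝ)) ∧
      G.IsFlowAdmissible σ := by
    obtain ⟨σ, hσ, hanti⟩ : ∃ σ, G.HasIntNowhereZeroFlow σ 4 ∧ ¬ G.IsAntibalanced σ := by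
      -- The negation covers all 1-factors at once, which the exchange of 1-factors in
      -- `IsComponent.isTripleEdge` needs.
      by_contra! hcon
      refine hH3 (hH.isTripleEdge hcubic hloop hfactor fun M hM e f a b c he hf hab hbc => ?_)
      refine hM.eq_of_isLink_of_isLink hcubic hV hloop (fun e u v he h => ?_) he hf hab hbc
      obtain ⟨σ, hσ, h4⟩ := hM.exists_hasIntNowhereZeroFlow_four hcubic h he
      exact h4 (hcon σ hσ)
    refine ⟨σ, Graph.circularFlowNumber_eq_of_forall_le hσ fun s hs => ?_, 4, by norm_num,
      hσ.hasNowhereZeroFlow⟩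
    by_contra! h
    exact hanti (hs.isAntibalanced hcubic h)
  refine ⟨?_, ⟨σ₃, hσ₃⟩, ⟨σ₄, hσ₄⟩⟩
  rintro _ (rfl | rfl)
  · exact ⟨⟨σ₃, hadm₃, hσ₃.1⟩, ⟨σ₃, hadm₃, hσ₃.2⟩⟩
  · exact ⟨⟨σ₄, hadm₄, hσ₄.1⟩, ⟨σ₄, hadm₄, hσ₄.2⟩⟩
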